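/- Let $N\ge 1$, let $\mathbf n\in\mathbb R^3$ be a unit vector, and let $\hat J_{\mathbf n}=\frac12\sum_{i=1}^N \mathbf n\cdot\hat{\boldsymbol\sigma}^{(i)}$ be the collective angular momentum of $N$ qubits, where $\hat{\boldsymbol\sigma}^{(i)}$ is the vector of Pauli matrices of the $i$th qubit. For a state $\hat\rho=\sum_k\lambda_k|k\rangle\langle k|$ (spectral decomposition) let $$F_Q[\hat\rho,\hat J_{\mathbf n}]=2\sum_{k,l:\,\lambda_k+\lambda_l>0}\frac{(\lambda_k-\lambda_l)^2}{\lambda_k+\lambda_l}\,\bigl|\langle k|\hat J_{\mathbf n}|l\rangle\bigr|^2$$ be its quantum Fisher information. For a partition $\Lambda=\{A_1,\dots,A_{|\Lambda|}\}$ of the $N$ qubits into nonempty disjoint subsets of sizes $N_l=|A_l|$, a state is $\Lambda$-separable if it is of the form $\sum_\gamma p_\gamma\,\hat\rho^{(\gamma)}_{A_1}\otimes\cdots\otimes\hat\rho^{(\gamma)}_{A_{|\Lambda|}}$ with a probability distribution $p_\gamma$ and states $\hat\rho^{(\gamma)}_{A_l}$ of the qubits in $A_l$. For an integer $r\ge-(N-1)$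 let $\mathcal L_{r}=\{\Lambda : \max_l N_l-|\Lambda|\le r\}$ be the set of partitions with Dyson's rank at most $r$; a state has Dyson's rank at most $r$ if it is a mixture $\sum_{\Lambda\in\mathcal L_r}P_\Lambda\hat\rho_\Lambda$ of $\Lambda$-separable states $\hat\rho_\Lambda$, with $P_\Lambda$ a probability distribution. Put $$f^{\nwsearrow}_N(r)=\max_{\Lambda\in\mathcal L_r}\sum_{l=1}^{|\Lambda|}N_l^2 .$$ Then $$\max_{\hat\rho}F_Q[\hat\rho,\hat J_{\mathbf n}]=f^{\nwsearrow}_N(r),$$ where the maximum is over all states $\hat\rho$ with Dyson's rank at most $r$ and is attained. Moreover, every state $\hat\rho$ with Dyson's rank at most $r$ satisfies $$F_Q[\hat\rho,\hat J_{\mathbf n}]\le\frac{(N+r)^2}{4}-\frac14+N\quad\text{if } r\ne 4-N,\qquad F_Q[\hat\rho,\hat J_{\mathbf n}]\le N+4\quad\text{if } r=4-N .$$ -/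

import Mathlib

open scoped BigOperators ComplexOrder

noncomputable section

/-- The operators on the Hilbert space of the qubits labelled by `ι`, that is, on the tensor
product of one copy of `ℂ²` for every `i : ι`, as matrices in the product basis; a basis vector
is a map `ι → Fin 2` (`0` for spin up, `1` for spin down). -/
abbrev QubitOp (ι : Type) : Type := Matrix (ι → Fin 2) (ι → Fin 2) ℂ

/-- A quantum state, i.e. a density matrix: positive semidefinite with trace one. -/
def IsDensityMatrix {κ : Type} [Fintype κ] (ρ : Matrix κ κ ℂ) : Prop :=
  ρ.PosSemidef ∧ ρ.trace = 1

/-- The Pauli matrices `σ_x, σ_y, σ_z`. -/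
def pauli : Fin 3 → Matrix (Fin 2) (Fin 2) ℂ :=
  ![!![0, 1; 1, 0], !![0, -Complex.I; Complex.I, 0], !![1, 0; 0, -1]]

/-- The single-qubit operator `A` acting on the `i`-th of `N` qubits, `1 ⊗ ⋯ ⊗ A ⊗ ⋯ ⊗ 1`. -/
def siteOp {N : ℕ} (i : Fin N) (A : Matrix (Fin 2) (Fin 2) ℂ) : QubitOp (Fin N) :=
  Matrix.of fun x y => ∏ j, (if j = i then A else 1) (x j) (y j)

/-- The collective angular momentum `J_n = ∑ᵢ n·σ⁽ⁱ⁾ / 2` in the direction `n`. -/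
def collectiveSpin (N : ℕ) (n : EuclideanSpace ℝ (Fin 3)) : QubitOp (Fin N) :=
  ∑ i : Fin N, ∑ a : Fin 3, ((n a / 2 : ℝ) : ℂ) • siteOp i (pauli a)

open Classical in
/-- The quantum Fisher information `F_Q[ρ, H]` of the state `ρ` for the phase `θ` imprinted by
`ρ ↦ exp(-iHθ) ρ exp(iHθ)`:
`F_Q[ρ, H] = 2 ∑_{k,l} (λ_k - λ_l)² / (λ_k + λ_l) |⟨k|H|l⟩|²`,
where `ρ = ∑_k λ_k |k⟩⟨k|` is the spectral decomposition and the sum is over the pairs with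
`λ_k + λ_l > 0` (for a state, `λ_k + λ_l = 0` forces `λ_k = λ_l = 0`).
The value `0` for matrices that are not Hermitian is never used for a state. -/
def qfi {κ : Type} [Fintype κ] (ρ H : Matrix κ κ ℂ) : ℝ :=
  if hρ : ρ.IsHermitian then
    2 * ∑ k, ∑ l, if 0 < hρ.eigenvalues k + hρ.eigenvalues l then
        (hρ.eigenvalues k - hρ.eigenvalues l) ^ 2 / (hρ.eigenvalues k + hρ.eigenvalues l) *
          ‖(star (hρ.eigenvectorUnitary : Matrix κ κ ℂ) * H *
            (hρ.eigenvectorUnitary : Matrix κ κ ℂ)) k l‖ ^ 2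
      else 0
  else 0

/-- A partition of the `N` qubits into nonempty, disjoint subsets. -/
abbrev QubitPartition (N : ℕ) : Type := Finpartition (Finset.univ : Finset (Fin N))

/-- The tensor product over the subsets `A` of the partition `Λ` of the operators `σ A` on the
qubits in `A`. -/
def partitionTensor {N : ℕ} (Λ : QubitPartition N) (σ : (A : Finset (Fin N)) → QubitOp A) :
    QubitOp (Fin N) :=
  Matrix.of fun x y => ∏ A ∈ Λ.parts, σ A (fun i => x i) (fun i => y i)

/-- `ρ` is `Λ`-separable: a finite mixture of tensor products of states of the subsets in `Λ`. -/
def IsPartitionSeparable {N : ℕ} (Λ : QubitPartition N) (ρ : QubitOp (Fin N)) : Prop :=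
  ∃ (m : ℕ) (p : Fin m → ℝ) (σ : Fin m → (A : Finset (Fin N)) → QubitOp A),
    (∀ γ, 0 ≤ p γ) ∧ ∑ γ, p γ = 1 ∧
    (∀ γ, ∀ A ∈ Λ.parts, IsDensityMatrix (σ γ A)) ∧
    ρ = ∑ γ, (p γ : ℂ) • partitionTensor Λ (σ γ)

/-- The width `w = max Λ` of a partition: the size of its largest subset. -/
def partitionWidth {N : ℕ} (Λ : QubitPartition N) : ℕ := Λ.parts.sup Finset.card

/-- The height `h = |Λ|` of a partition: the number of its subsets. -/
def partitionHeight {N : ℕ} (Λ : QubitPartition N) : ℕ := Λ.parts.card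

/-- Dyson's rank `w - h` of a partition. -/
def dysonRank {N : ℕ} (Λ : QubitPartition N) : ℤ :=
  (partitionWidth Λ : ℤ) - (partitionHeight Λ : ℤ)

/-- The set of the partitions of `N` qubits with Dyson's rank at most `r`. -/
def rankPartitions (N : ℕ) (r : ℤ) : Finset (QubitPartition N) :=
  Finset.univ.filter fun Λ => dysonRank Λ ≤ r

/-- `ρ` is a state with Dyson's rank not larger than `r`: a mixture of `Λ`-separable states, over
the partitions `Λ` with Dyson's rank at most `r`. -/
def HasDysonRankLE {N : ℕ} (r : ℤ) (ρ : QubitOp (Fin N)) : Prop :=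
  ∃ (P : QubitPartition N → ℝ) (τ : QubitPartition N → QubitOp (Fin N)),
    (∀ Λ ∈ rankPartitions N r, 0 ≤ P Λ) ∧ ∑ Λ ∈ rankPartitions N r, P Λ = 1 ∧
    (∀ Λ ∈ rankPartitions N r, IsPartitionSeparable Λ (τ Λ)) ∧
    ρ = ∑ Λ ∈ rankPartitions N r, (P Λ : ℂ) • τ Λ

/-- The maximum of `∑_l N_l²` over the partitions with Dyson's rank at most `r`, where the `N_l`
are the sizes of the subsets (there is such a partition as soon as `r ≥ -(N - 1)`). -/
def rankBound (N : ℕ) (r : ℤ) : ℕ :=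
  (rankPartitions N r).sup fun Λ => ∑ A ∈ Λ.parts, A.card ^ 2

end

/-!
The quantum Fisher information is a maximum over Hermitian matrices,
`F_Q[ρ, H] = max_X Tr(ρ (2i[H, X] - X²))`. Being a maximum of functions that are linear in `ρ`, it
is convex, and completing the square in `X` shows that it is at most four times the variance of `H`,
with equality for pure states. By convexity the upper bound only has to be checked on a product of
states of the blocks of a partition. There the covariance of one-qubit operators in different blocks
vanishes, and within a block it is at most a quarter of the squared gap between the eigenvalues of
the one-qubit operator. A product of Greenberger-Horne-Zeilinger states saturates both facts.

For the bounds in terms of `r`, let a partition have width `w` and height `h`. Since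
`∑ (N_l - 1) = N - h`, one has `∑ N_l (N_l - 1) ≤ w (N - h)`, and
`4 w (N - h) = (w + N - h) ^ 2 - (w - (N - h)) ^ 2` is at most `(N + r) ^ 2 - 1` unless `w = N - h`.
In that case all blocks but a largest one are singletons and a single pair, which spoils the bound
only when the largest block is itself a pair.
-/

open Matrix

section Covariance

lemma isHermitian_sub_ofReal_smul_one {κ : Type*} [DecidableEq κ] {A : Matrix κ κ ℂ}
    (hA : A.IsHermitian) (c : ℝ) : (A - (c : ℂ) • (1 : Matrix κ κ ℂ)).IsHermitian :=
  hA.sub (isHermitian_one.smul (Complex.conj_ofReal c))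

variable {κ : Type} [Fintype κ]

/-- The expectation value `⟨M⟩ = Tr(ρ M)`. The real part is taken so that values are real also for
observables that are not Hermitian; for Hermitian `A` and `B`, `expval ρ (A * B)` is therefore the
symmetrized product moment `⟨AB + BA⟩ / 2`. -/
noncomputable def expval (ρ M : Matrix κ κ ℂ) : ℝ := (ρ * M).trace.re

lemma expval_sub (ρ M M' : Matrix κ κ ℂ) : expval ρ (M - M') = expval ρ M - expval ρ M' := by
  simp [expval, Matrix.mul_sub]

lemma expval_ofReal_smul (ρ M : Matrix κ κ ℂ) (c : ℝ) :
    expval ρ ((c : ℂ) • M) = c * expval ρ M := by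
  simp [expval]

lemma expval_sum {ι : Type*} (s : Finset ι) (ρ : Matrix κ κ ℂ) (M : ι → Matrix κ κ ℂ) :
    expval ρ (∑ i ∈ s, M i) = ∑ i ∈ s, expval ρ (M i) := by
  simp [expval, Matrix.mul_sum, Matrix.trace_sum]

lemma expval_mixture {ι : Type*} (s : Finset ι) (p : ι → ℝ) (ρ : ι → Matrix κ κ ℂ)
    (M : Matrix κ κ ℂ) :
    expval (∑ i ∈ s, (p i : ℂ) • ρ i) M = ∑ i ∈ s, p i * expval (ρ i) M := by
  simp [expval, Matrix.sum_mul, Matrix.trace_sum]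

lemma expval_one [DecidableEq κ] {ρ : Matrix κ κ ℂ} (hρ : ρ.trace = 1) : expval ρ 1 = 1 := by
  simp [expval, hρ]

lemma expval_conjTranspose {ρ : Matrix κ κ ℂ} (hρ : ρ.IsHermitian) (M : Matrix κ κ ℂ) :
    expval ρ Mᴴ = expval ρ M := by
  rw [expval, ← Complex.conj_re, ← RCLike.star_def, ← trace_conjTranspose, conjTranspose_mul,
    conjTranspose_conjTranspose, hρ.eq, trace_mul_comm, expval]

lemma expval_conjTranspose_mul_self_nonneg {ρ : Matrix κ κ ℂ} (hρ : ρ.PosSemidef)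
    (M : Matrix κ κ ℂ) : 0 ≤ expval ρ (Mᴴ * M) := by
  have h := (hρ.mul_mul_conjTranspose_same M).trace_nonneg
  rw [Matrix.mul_assoc, trace_mul_comm, Matrix.mul_assoc] at h
  exact (Complex.le_def.1 h).1

lemma trace_mul_eq_expval {ρ M : Matrix κ κ ℂ} (hρ : ρ.IsHermitian) (hM : M.IsHermitian) :
    (ρ * M).trace = expval ρ M := by
  refine (Complex.conj_eq_iff_re.1 ?_).symm
  rw [← RCLike.star_def, ← trace_conjTranspose, conjTranspose_mul, hρ.eq, hM.eq, trace_mul_comm]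

lemma expval_vecMulVec_star (ψ : κ → ℂ) (M : Matrix κ κ ℂ) :
    expval (vecMulVec ψ (star ψ)) M = ((M *ᵥ ψ) ⬝ᵥ star ψ).re := by
  rw [expval, trace_mul_comm, mul_vecMulVec, trace_vecMulVec]

/-- The covariance `⟨AB⟩ - ⟨A⟩⟨B⟩` of two observables; `covariance ρ A A` is the variance. -/
noncomputable def covariance (ρ A B : Matrix κ κ ℂ) : ℝ :=
  expval ρ (A * B) - expval ρ A * expval ρ B

lemma covariance_comm {ρ A B : Matrix κ κ ℂ} (hρ : ρ.IsHermitian) (hA : A.IsHermitian)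
    (hB : B.IsHermitian) : covariance ρ A B = covariance ρ B A := by
  rw [covariance, covariance, ← expval_conjTranspose hρ (A * B), conjTranspose_mul, hA.eq, hB.eq,
    mul_comm (expval ρ A)]

lemma covariance_sum_sum {ι : Type*} (s : Finset ι) (ρ : Matrix κ κ ℂ) (A : ι → Matrix κ κ ℂ) :
    covariance ρ (∑ i ∈ s, A i) (∑ j ∈ s, A j) = ∑ i ∈ s, ∑ j ∈ s, covariance ρ (A i) (A j) := by
  simp only [covariance, expval_sum, Finset.sum_mul_sum, Finset.sum_sub_distrib]

lemma covariance_self_eq_expval_centered [DecidableEq κ] {ρ : Matrix κ κ ℂ} (hρ : ρ.trace = 1)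
    (A : Matrix κ κ ℂ) :
    covariance ρ A A = expval ρ ((A - (expval ρ A : ℂ) • 1) * (A - (expval ρ A : ℂ) • 1)) := by
  simp only [covariance, sub_mul, mul_sub, smul_mul_assoc, mul_smul_comm, one_mul, mul_one,
    expval_sub, expval_ofReal_smul, expval_one hρ]
  ring

lemma covariance_self_le_of_mul_self_eq [DecidableEq κ] {ρ A : Matrix κ κ ℂ} (hρ : ρ.trace = 1)
    {a b : ℝ}
    (hA : A * A = ((a + b : ℝ) : ℂ) • A - ((a * b : ℝ) : ℂ) • (1 : Matrix κ κ ℂ)) :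
    covariance ρ A A ≤ (a - b) ^ 2 / 4 := by
  rw [covariance, hA, expval_sub, expval_ofReal_smul, expval_ofReal_smul, expval_one hρ]
  nlinarith [sq_nonneg (expval ρ A - (a + b) / 2)]

lemma covariance_self_nonneg {ρ A : Matrix κ κ ℂ} (hρ : IsDensityMatrix ρ)
    (hA : A.IsHermitian) : 0 ≤ covariance ρ A A := by
  classical
  have h := expval_conjTranspose_mul_self_nonneg hρ.1 (A - (expval ρ A : ℂ) • 1)
  rwa [(isHermitian_sub_ofReal_smul_one hA _).eq, ← covariance_self_eq_expval_centered hρ.2] at h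

lemma covariance_le_of_covariance_self_le {ρ A B : Matrix κ κ ℂ} (hρ : IsDensityMatrix ρ)
    (hA : A.IsHermitian) (hB : B.IsHermitian) {c : ℝ} (hAc : covariance ρ A A ≤ c)
    (hBc : covariance ρ B B ≤ c) : covariance ρ A B ≤ c := by
  have hexpand : covariance ρ (A - B) (A - B) =
      covariance ρ A A + covariance ρ B B - covariance ρ A B - covariance ρ B A := by
    simp only [covariance, sub_mul, mul_sub, expval_sub]
    ring
  have hnonneg := covariance_self_nonneg hρ (hA.sub hB)
  rw [hexpand, covariance_comm hρ.1.1 hB hA] at hnonneg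
  linarith

end Covariance

section QuantumFisherInformation

variable {κ : Type} [Fintype κ]

/-- The functional `X ↦ Tr(ρ (2i[H, X] - X²))`, whose maximum over the Hermitian matrices `X` is the
quantum Fisher information; the maximizer is the symmetric logarithmic derivative. -/
noncomputable def sldForm (ρ H X : Matrix κ κ ℂ) : ℝ :=
  expval ρ ((2 * Complex.I) • (H * X - X * H) - X * X)

lemma sldForm_mixture {ι : Type*} (s : Finset ι) (p : ι → ℝ) (ρ : ι → Matrix κ κ ℂ)
    (H X : Matrix κ κ ℂ) :
    sldForm (∑ i ∈ s, (p i : ℂ) • ρ i) H X = ∑ i ∈ s, p i * sldForm (ρ i) H X :=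
  expval_mixture s p ρ _

lemma sldForm_eq_re_trace (ρ H X : Matrix κ κ ℂ) :
    sldForm ρ H X = (((2 * Complex.I) • (ρ * H - H * ρ) -
      (1 / 2 : ℂ) • (ρ * X + X * ρ)) * X).trace.re := by
  have hlin : (ρ * (X * H)).trace = (H * ρ * X).trace := by
    rw [← Matrix.mul_assoc, trace_mul_comm, ← Matrix.mul_assoc]
  have hquad : (X * ρ * X).trace = (ρ * X * X).trace := by
    rw [Matrix.mul_assoc, trace_mul_comm]
  rw [sldForm, expval]
  refine congrArg Complex.re ?_
  simp only [Matrix.mul_sub, Matrix.sub_mul, Matrix.add_mul, Matrix.mul_smul, Matrix.smul_mul,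
    trace_sub, trace_add, trace_smul, smul_eq_mul, hlin, hquad]
  rw [← Matrix.mul_assoc, ← Matrix.mul_assoc]
  ring

lemma sldForm_diagonal [DecidableEq κ] (d : κ → ℝ) (H : Matrix κ κ ℂ) {X : Matrix κ κ ℂ}
    (hX : X.IsHermitian) :
    sldForm (diagonal fun k => (d k : ℂ)) H X =
      ∑ k, ∑ l, ((2 * Complex.I * (d k - d l) * H k l - (d k + d l) / 2 * X k l) *
        star (X k l)).re := by
  rw [sldForm_eq_re_trace, trace, Complex.re_sum]
  refine Finset.sum_congr rfl fun k _ => ?_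
  rw [diag_apply, mul_apply, Complex.re_sum]
  refine Finset.sum_congr rfl fun l _ => ?_
  rw [← hX.apply l k]
  simp only [Matrix.sub_apply, Matrix.add_apply, Matrix.smul_apply, smul_eq_mul, diagonal_mul,
    mul_diagonal]
  congr 1
  ring

lemma sldForm_conjStarAlgAut [DecidableEq κ] (U : unitary (Matrix κ κ ℂ)) (ρ H X : Matrix κ κ ℂ) :
    sldForm (Unitary.conjStarAlgAut ℂ _ U ρ) (Unitary.conjStarAlgAut ℂ _ U H)
      (Unitary.conjStarAlgAut ℂ _ U X) = sldForm ρ H X := by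
  have htrace : ∀ M, (Unitary.conjStarAlgAut ℂ (Matrix κ κ ℂ) U M).trace = M.trace := fun M => by
    rw [Unitary.conjStarAlgAut_apply, trace_mul_comm, ← Matrix.mul_assoc, Unitary.coe_star_mul_self,
      Matrix.one_mul]
  simp only [sldForm, expval, ← map_mul, ← map_sub, ← map_smul, htrace]

/-- Completing the square in `x`. Division by `0` returns `0`, which is the right value at
`a = b = 0`. -/
lemma re_sld_eq_sub_sq {a b : ℝ} (ha : 0 ≤ a) (hb : 0 ≤ b) (h x : ℂ) :
    ((2 * Complex.I * (a - b) * h - (a + b) / 2 * x) * star x).re =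
      2 * ((a - b) ^ 2 / (a + b) * ‖h‖ ^ 2) -
        (a + b) / 2 * ‖x - (2 * (a - b) / (a + b) : ℝ) * Complex.I * h‖ ^ 2 := by
  rcases (add_nonneg ha hb).eq_or_lt' with hab | hab
  · obtain rfl : a = 0 := by linarith
    obtain rfl : b = 0 := by linarith
    simp
  · simp only [← Complex.normSq_eq_norm_sq, Complex.normSq_apply, RCLike.star_def]
    simp only [Complex.mul_re, Complex.mul_im, Complex.sub_re, Complex.sub_im, Complex.add_re,
      Complex.add_im, Complex.re_ofNat, Complex.im_ofNat, Complex.I_re, Complex.I_im,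
      Complex.ofReal_re, Complex.ofReal_im, Complex.div_ofNat_re, Complex.div_ofNat_im,
      Complex.conj_re, Complex.conj_im, mul_zero, zero_mul, mul_one, add_zero, zero_add, sub_self,
      sub_zero, zero_sub, zero_div, mul_neg, sub_neg_eq_add]
    field_simp
    ring

open Classical in
/-- The matrix `M` in the eigenbasis `|k⟩` of `ρ` used by `qfi`, with entries `⟨k|M|l⟩`. -/
noncomputable def inEigenbasis {ρ : Matrix κ κ ℂ} (hρ : ρ.IsHermitian) (M : Matrix κ κ ℂ) :
    Matrix κ κ ℂ :=
  (Unitary.conjStarAlgAut ℂ _ hρ.eigenvectorUnitary).symm M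

open Classical in
lemma qfi_eq_sum_inEigenbasis {ρ : Matrix κ κ ℂ} (hρ : ρ.PosSemidef) (H : Matrix κ κ ℂ) :
    qfi ρ H = ∑ k, ∑ l, 2 * ((hρ.1.eigenvalues k - hρ.1.eigenvalues l) ^ 2 /
      (hρ.1.eigenvalues k + hρ.1.eigenvalues l) * ‖inEigenbasis hρ.1 H k l‖ ^ 2) := by
  rw [qfi, dif_pos hρ.1, Finset.mul_sum]
  refine Finset.sum_congr rfl fun k _ => ?_
  rw [Finset.mul_sum]
  refine Finset.sum_congr rfl fun l _ => ?_
  rw [← Unitary.conjStarAlgAut_symm_apply (S := ℂ), ← inEigenbasis]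
  split_ifs with hpos
  · rfl
  · have hzero : hρ.1.eigenvalues k + hρ.1.eigenvalues l = 0 :=
      le_antisymm (not_lt.1 hpos) (add_nonneg (hρ.eigenvalues_nonneg k) (hρ.eigenvalues_nonneg l))
    rw [hzero, div_zero, zero_mul]

open Classical in
lemma sldForm_eq_qfi_sub {ρ X : Matrix κ κ ℂ} (hρ : ρ.PosSemidef) (H : Matrix κ κ ℂ)
    (hX : X.IsHermitian) :
    sldForm ρ H X = qfi ρ H - ∑ k, ∑ l, (hρ.1.eigenvalues k + hρ.1.eigenvalues l) / 2 *
      ‖inEigenbasis hρ.1 X k l - (2 * (hρ.1.eigenvalues k - hρ.1.eigenvalues l) /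
        (hρ.1.eigenvalues k + hρ.1.eigenvalues l) : ℝ) * Complex.I *
          inEigenbasis hρ.1 H k l‖ ^ 2 := by
  set φ := Unitary.conjStarAlgAut ℂ _ hρ.1.eigenvectorUnitary with hφ
  have hdiag : sldForm ρ H X = sldForm (diagonal fun k => (hρ.1.eigenvalues k : ℂ))
      (inEigenbasis hρ.1 H) (inEigenbasis hρ.1 X) := by
    rw [← sldForm_conjStarAlgAut hρ.1.eigenvectorUnitary (diagonal _)]
    simp only [inEigenbasis, ← hφ, StarAlgEquiv.apply_symm_apply]
    exact congrArg (sldForm · H X) hρ.1.spectral_theorem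
  have hX' : (inEigenbasis hρ.1 X).IsHermitian := hX.isSelfAdjoint.map φ.symm
  rw [hdiag, sldForm_diagonal _ _ hX', qfi_eq_sum_inEigenbasis hρ]
  simp only [← Finset.sum_sub_distrib, re_sld_eq_sub_sq (hρ.eigenvalues_nonneg _)
    (hρ.eigenvalues_nonneg _)]

lemma sldForm_le_qfi {ρ X : Matrix κ κ ℂ} (hρ : ρ.PosSemidef) (H : Matrix κ κ ℂ)
    (hX : X.IsHermitian) : sldForm ρ H X ≤ qfi ρ H := by
  classical
  rw [sldForm_eq_qfi_sub hρ H hX]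
  refine sub_le_self _ (Finset.sum_nonneg fun k _ => Finset.sum_nonneg fun l _ => ?_)
  have hk := hρ.eigenvalues_nonneg k
  have hl := hρ.eigenvalues_nonneg l
  positivity

lemma exists_isHermitian_sldForm_eq_qfi {ρ H : Matrix κ κ ℂ} (hρ : ρ.PosSemidef)
    (hH : H.IsHermitian) : ∃ X : Matrix κ κ ℂ, X.IsHermitian ∧ sldForm ρ H X = qfi ρ H := by
  classical
  set d := hρ.1.eigenvalues
  set φ := Unitary.conjStarAlgAut ℂ _ hρ.1.eigenvectorUnitary
  let L : Matrix κ κ ℂ := of fun k l =>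
    (2 * (d k - d l) / (d k + d l) : ℝ) * Complex.I * inEigenbasis hρ.1 H k l
  have hH' : (inEigenbasis hρ.1 H).IsHermitian := hH.isSelfAdjoint.map φ.symm
  have hL : L.IsHermitian := IsHermitian.ext fun k l => by
    simp only [L, of_apply]
    rw [star_mul', star_mul', hH'.apply, ← neg_sub (d k) (d l), add_comm (d l)]
    simp only [RCLike.star_def, Complex.conj_ofReal, Complex.conj_I]
    push_cast
    ring
  have hX : (φ L).IsHermitian := hL.isSelfAdjoint.map φ
  have hbasis : inEigenbasis hρ.1 (φ L) = L := φ.symm_apply_apply L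
  refine ⟨φ L, hX, ?_⟩
  rw [sldForm_eq_qfi_sub hρ H hX, hbasis]
  simp [L, d]

lemma qfi_mixture_le {ι : Type*} {s : Finset ι} {p : ι → ℝ} {ρ : ι → Matrix κ κ ℂ}
    {H : Matrix κ κ ℂ} {c : ℝ} (hp : ∀ i ∈ s, 0 ≤ p i) (hp1 : ∑ i ∈ s, p i = 1)
    (hρ : ∀ i ∈ s, (ρ i).PosSemidef) (hH : H.IsHermitian) (hc : ∀ i ∈ s, qfi (ρ i) H ≤ c) :
    qfi (∑ i ∈ s, (p i : ℂ) • ρ i) H ≤ c := by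
  have hmix : (∑ i ∈ s, (p i : ℂ) • ρ i).PosSemidef :=
    posSemidef_sum s fun i hi => (hρ i hi).smul (Complex.zero_le_real.2 (hp i hi))
  obtain ⟨X, hX, hXqfi⟩ := exists_isHermitian_sldForm_eq_qfi hmix hH
  calc qfi (∑ i ∈ s, (p i : ℂ) • ρ i) H = ∑ i ∈ s, p i * sldForm (ρ i) H X := by
        rw [← hXqfi, sldForm_mixture]
    _ ≤ ∑ i ∈ s, p i * c := Finset.sum_le_sum fun i hi => mul_le_mul_of_nonneg_left
        ((sldForm_le_qfi (hρ i hi) H hX).trans (hc i hi)) (hp i hi)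
    _ = c := by rw [← Finset.sum_mul, hp1, one_mul]

lemma sldForm_le_four_mul_covariance {ρ H X : Matrix κ κ ℂ} (hρ : IsDensityMatrix ρ)
    (hH : H.IsHermitian) (hX : X.IsHermitian) : sldForm ρ H X ≤ 4 * covariance ρ H H := by
  classical
  set K := H - (expval ρ H : ℂ) • (1 : Matrix κ κ ℂ) with hK
  have hKherm : K.IsHermitian := isHermitian_sub_ofReal_smul_one hH _
  have hcomm : H * X - X * H = K * X - X * K := by
    simp [hK, Matrix.sub_mul, Matrix.mul_sub]
  have hsquare : (X + (2 * Complex.I) • K)ᴴ * (X + (2 * Complex.I) • K) =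
      ((4 : ℝ) : ℂ) • (K * K) - ((2 * Complex.I) • (H * X - X * H) - X * X) := by
    have hstar : star (2 * Complex.I) = -(2 * Complex.I) := by simp
    have hsq : 2 * Complex.I * (2 * Complex.I) = -((4 : ℝ) : ℂ) := by
      push_cast
      linear_combination 4 * Complex.I_mul_I
    rw [hcomm, conjTranspose_add, conjTranspose_smul, hKherm.eq, hX.eq, hstar]
    simp only [Matrix.add_mul, Matrix.mul_add, Matrix.smul_mul, Matrix.mul_smul, smul_sub,
      smul_add, neg_smul, neg_mul, smul_neg, smul_smul, hsq, neg_neg]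
    abel
  have hnonneg := expval_conjTranspose_mul_self_nonneg hρ.1 (X + (2 * Complex.I) • K)
  rw [hsquare, expval_sub, expval_ofReal_smul, hK, ← covariance_self_eq_expval_centered hρ.2]
    at hnonneg
  exact sub_nonneg.1 hnonneg

theorem qfi_le_four_mul_covariance {ρ H : Matrix κ κ ℂ} (hρ : IsDensityMatrix ρ)
    (hH : H.IsHermitian) : qfi ρ H ≤ 4 * covariance ρ H H := by
  obtain ⟨X, hX, hXqfi⟩ := exists_isHermitian_sldForm_eq_qfi hρ.1 hH
  exact hXqfi ▸ sldForm_le_four_mul_covariance hρ hH hX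

lemma isDensityMatrix_vecMulVec_star {ψ : κ → ℂ} (hψ : ψ ⬝ᵥ star ψ = 1) :
    IsDensityMatrix (vecMulVec ψ (star ψ)) :=
  ⟨posSemidef_vecMulVec_self_star ψ, by rw [trace_vecMulVec, hψ]⟩

lemma vecMulVec_star_mul_mul_vecMulVec_star (ψ : κ → ℂ) (M : Matrix κ κ ℂ) :
    vecMulVec ψ (star ψ) * M * vecMulVec ψ (star ψ) =
      (vecMulVec ψ (star ψ) * M).trace • vecMulVec ψ (star ψ) := by
  rw [vecMulVec_mul, vecMulVec_mul_vecMulVec, trace_vecMulVec, vecMulVec_smul, dotProduct_comm]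

/-- The maximum is attained at the symmetric logarithmic derivative `2i[ρ, H]` of a pure state. -/
lemma sldForm_vecMulVec_star {ψ : κ → ℂ} (hψ : ψ ⬝ᵥ star ψ = 1) {H : Matrix κ κ ℂ}
    (hH : H.IsHermitian) :
    sldForm (vecMulVec ψ (star ψ)) H
      ((2 * Complex.I) • (vecMulVec ψ (star ψ) * H - H * vecMulVec ψ (star ψ))) =
        4 * covariance (vecMulVec ψ (star ψ)) H H := by
  classical
  have hρ := isDensityMatrix_vecMulVec_star hψ
  have hpure := vecMulVec_star_mul_mul_vecMulVec_star ψ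
  set ρ := vecMulVec ψ (star ψ)
  have hproj : ρ * ρ = ρ := by simpa [hρ.2] using hpure 1
  have hmean : ρ * H * ρ = (expval ρ H : ℂ) • ρ := by
    rw [hpure, trace_mul_eq_expval hρ.1.1 hH]
  have hproj' (M : Matrix κ κ ℂ) : ρ * (ρ * M) = ρ * M := by rw [← Matrix.mul_assoc, hproj]
  have hmean' (M : Matrix κ κ ℂ) : ρ * (H * (ρ * M)) = (expval ρ H : ℂ) • (ρ * M) := by
    rw [← Matrix.mul_assoc, ← Matrix.mul_assoc, hmean, Matrix.smul_mul]
  have hcyclic : (ρ * (H * (H * ρ))).trace = (ρ * (H * H)).trace := by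
    rw [← Matrix.mul_assoc H, ← Matrix.mul_assoc, trace_mul_comm, hproj']
  have hsq : 2 * Complex.I * (2 * Complex.I) = -4 := by linear_combination 4 * Complex.I_mul_I
  rw [Matrix.mul_assoc] at hmean
  rw [sldForm, covariance, expval, expval.eq_def ρ (H * H)]
  simp only [Matrix.mul_sub, Matrix.sub_mul, Matrix.mul_smul, Matrix.smul_mul, smul_sub, smul_smul,
    Matrix.mul_assoc, hsq, hmean, hmean', hproj', hcyclic, trace_sub, trace_smul, smul_eq_mul,
    trace_mul_eq_expval hρ.1.1 hH, hρ.2]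
  simp only [Complex.sub_re, Complex.add_re, Complex.neg_re, Complex.mul_re, Complex.mul_im,
    Complex.re_ofNat, Complex.im_ofNat, Complex.ofReal_re, Complex.ofReal_im, Complex.I_re,
    Complex.I_im, neg_mul, sub_neg_eq_add, mul_one, mul_zero, zero_mul, sub_zero, add_zero,
    sub_self, zero_add, zero_sub]
  ring

lemma qfi_vecMulVec_star {ψ : κ → ℂ} (hψ : ψ ⬝ᵥ star ψ = 1) {H : Matrix κ κ ℂ}
    (hH : H.IsHermitian) :
    qfi (vecMulVec ψ (star ψ)) H = 4 * covariance (vecMulVec ψ (star ψ)) H H := by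
  have hρ := isDensityMatrix_vecMulVec_star hψ
  refine (qfi_le_four_mul_covariance hρ hH).antisymm ?_
  rw [← sldForm_vecMulVec_star hψ hH]
  refine sldForm_le_qfi hρ.1 H ?_
  rw [IsHermitian, conjTranspose_smul, conjTranspose_sub, conjTranspose_mul, conjTranspose_mul,
    hρ.1.1.eq, hH.eq, ← neg_sub (H * _), smul_neg]
  simp

end QuantumFisherInformation

section TensorProducts

variable {ι : Type} [Fintype ι]

/-- The tensor product of single-qubit operators. -/
noncomputable def tensorOp (M : ι → Matrix (Fin 2) (Fin 2) ℂ) : QubitOp ι :=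
  of fun x y => ∏ j, M j (x j) (y j)

/-- The tensor product of single-qubit vectors. -/
noncomputable def tensorVec (w : ι → Fin 2 → ℂ) : (ι → Fin 2) → ℂ :=
  fun x => ∏ j, w j (x j)

lemma tensorOp_mul [DecidableEq ι] (M M' : ι → Matrix (Fin 2) (Fin 2) ℂ) :
    tensorOp M * tensorOp M' = tensorOp fun j => M j * M' j := by
  ext x y
  simp only [tensorOp, mul_apply, of_apply, ← Finset.prod_mul_distrib]
  rw [Finset.prod_univ_sum, Fintype.piFinset_univ]

lemma tensorOp_one : tensorOp (fun _ : ι => 1) = 1 := by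
  ext x y
  simp only [tensorOp, of_apply, one_apply, Finset.prod_ite_zero, Finset.mem_univ, true_implies,
    funext_iff, Finset.prod_const_one]

lemma tensorOp_conjTranspose (M : ι → Matrix (Fin 2) (Fin 2) ℂ) :
    (tensorOp M)ᴴ = tensorOp fun j => (M j)ᴴ := by
  ext x y
  simp [tensorOp, conjTranspose_apply]

lemma tensorOp_mulVec [DecidableEq ι] (M : ι → Matrix (Fin 2) (Fin 2) ℂ) (w : ι → Fin 2 → ℂ) :
    tensorOp M *ᵥ tensorVec w = tensorVec fun j => M j *ᵥ w j := by
  ext x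
  simp only [tensorOp, tensorVec, mulVec, dotProduct, of_apply, ← Finset.prod_mul_distrib]
  rw [Finset.prod_univ_sum, Fintype.piFinset_univ]

lemma tensorVec_dotProduct_star [DecidableEq ι] (w w' : ι → Fin 2 → ℂ) :
    tensorVec w ⬝ᵥ star (tensorVec w') = ∏ j, w j ⬝ᵥ star (w' j) := by
  simp only [tensorVec, dotProduct, Pi.star_apply, star_prod, ← Finset.prod_mul_distrib]
  rw [Finset.prod_univ_sum, Fintype.piFinset_univ]

lemma tensorVec_smul (c : ι → ℂ) (w : ι → Fin 2 → ℂ) :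
    tensorVec (fun j => c j • w j) = (∏ j, c j) • tensorVec w := by
  ext x
  simp [tensorVec, Finset.prod_mul_distrib]

end TensorProducts

section SiteOperators

variable {N : ℕ}

lemma siteOp_eq_tensorOp (i : Fin N) (K : Matrix (Fin 2) (Fin 2) ℂ) :
    siteOp i K = tensorOp fun j => if j = i then K else 1 := rfl

lemma siteOp_apply (i : Fin N) (K : Matrix (Fin 2) (Fin 2) ℂ) (x y : Fin N → Fin 2) :
    siteOp i K x y =
      K (x i) (y i) * ∏ j ∈ Finset.univ.erase i, (1 : Matrix (Fin 2) (Fin 2) ℂ) (x j) (y j) := by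
  rw [siteOp, of_apply, ← Finset.mul_prod_erase _ _ (Finset.mem_univ i), if_pos rfl]
  exact congrArg _ (Finset.prod_congr rfl fun j hj => by rw [if_neg (Finset.ne_of_mem_erase hj)])

/-- The map `K ↦ siteOp i K` as a homomorphism of star algebras. -/
noncomputable def siteStarAlgHom (i : Fin N) :
    Matrix (Fin 2) (Fin 2) ℂ →⋆ₐ[ℂ] QubitOp (Fin N) where
  toFun := siteOp i
  map_one' := by simp only [siteOp_eq_tensorOp, ite_self, tensorOp_one]
  map_mul' K K' := by
    simp only [siteOp_eq_tensorOp, tensorOp_mul]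
    congr 1
    ext j : 1
    split_ifs <;> simp
  map_zero' := by ext; simp [siteOp_apply]
  map_add' K K' := by ext; simp [siteOp_apply, add_mul]
  commutes' c := by
    have hone : siteOp i 1 = 1 := by simp only [siteOp_eq_tensorOp, ite_self, tensorOp_one]
    simp only [Algebra.algebraMap_eq_smul_one, ← hone]
    ext
    simp [siteOp_apply, mul_assoc]
  map_star' K := by
    simp only [star_eq_conjTranspose, siteOp_eq_tensorOp, tensorOp_conjTranspose]
    congr 1
    ext j : 1
    split_ifs <;> simp

lemma siteStarAlgHom_apply (i : Fin N) (K : Matrix (Fin 2) (Fin 2) ℂ) :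
    siteStarAlgHom i K = siteOp i K := rfl

lemma isHermitian_siteOp (i : Fin N) {K : Matrix (Fin 2) (Fin 2) ℂ} (hK : K.IsHermitian) :
    (siteOp i K).IsHermitian :=
  hK.isSelfAdjoint.map (siteStarAlgHom i)

lemma isHermitian_sum_siteOp {K : Matrix (Fin 2) (Fin 2) ℂ} (hK : K.IsHermitian) :
    (∑ i : Fin N, siteOp i K).IsHermitian :=
  isSelfAdjoint_sum _ fun i _ => (isHermitian_siteOp i hK).isSelfAdjoint

lemma trace_eq_add_eigenvalues {K : Matrix (Fin 2) (Fin 2) ℂ} (hK : K.IsHermitian) :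
    K.trace = ((hK.eigenvalues 0 + hK.eigenvalues 1 : ℝ) : ℂ) := by
  simp [hK.trace_eq_sum_eigenvalues]

lemma det_eq_mul_eigenvalues {K : Matrix (Fin 2) (Fin 2) ℂ} (hK : K.IsHermitian) :
    K.det = ((hK.eigenvalues 0 * hK.eigenvalues 1 : ℝ) : ℂ) := by
  simp [hK.det_eq_prod_eigenvalues]

lemma mul_self_eq_eigenvalues {K : Matrix (Fin 2) (Fin 2) ℂ} (hK : K.IsHermitian) :
    K * K = ((hK.eigenvalues 0 + hK.eigenvalues 1 : ℝ) : ℂ) • K -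
      ((hK.eigenvalues 0 * hK.eigenvalues 1 : ℝ) : ℂ) • (1 : Matrix (Fin 2) (Fin 2) ℂ) := by
  have hcayley := aeval_self_charpoly K
  rw [charpoly_fin_two, trace_eq_add_eigenvalues hK, det_eq_mul_eigenvalues hK, map_add, map_sub,
    map_mul, map_pow, Polynomial.aeval_X, Polynomial.aeval_C, Polynomial.aeval_C,
    ← Algebra.smul_def, Algebra.algebraMap_eq_smul_one, sq] at hcayley
  rwa [← sub_eq_zero, ← sub_add]

lemma covariance_siteOp_self_le {ρ : QubitOp (Fin N)} (hρ : ρ.trace = 1) (i : Fin N)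
    {K : Matrix (Fin 2) (Fin 2) ℂ} (hK : K.IsHermitian) :
    covariance ρ (siteOp i K) (siteOp i K) ≤ (hK.eigenvalues 0 - hK.eigenvalues 1) ^ 2 / 4 := by
  refine covariance_self_le_of_mul_self_eq hρ ?_
  rw [← siteStarAlgHom_apply, ← map_mul, mul_self_eq_eigenvalues hK, map_sub, map_smul, map_smul,
    map_one]

end SiteOperators

section PartitionTensor

variable {N : ℕ} (Λ : QubitPartition N)

/-- A configuration of all qubits amounts to a configuration of every subset of a partition. -/
def configEquiv : (Fin N → Fin 2) ≃ ((A : Λ.parts) → A.1 → Fin 2) where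
  toFun x _ i := x i
  invFun p i := p ⟨Λ.part i, Λ.part_mem.2 (Finset.mem_univ i)⟩
    ⟨i, Λ.mem_part_self.2 (Finset.mem_univ i)⟩
  left_inv _ := rfl
  right_inv p := by
    ext ⟨A, hA⟩ ⟨i, hi⟩ : 2
    obtain rfl := Λ.part_eq_of_mem hA hi
    rfl

lemma sum_prod_parts (f : (A : Finset (Fin N)) → (A → Fin 2) → ℂ) :
    ∑ x : Fin N → Fin 2, ∏ A ∈ Λ.parts, f A (fun i => x i) = ∏ A ∈ Λ.parts, ∑ y, f A y := by
  rw [← Finset.prod_coe_sort Λ.parts fun A => ∑ y, f A y, Finset.prod_univ_sum,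
    Fintype.piFinset_univ]
  refine Fintype.sum_equiv (configEquiv Λ) _ _ fun x => ?_
  rw [← Finset.prod_coe_sort]
  rfl

lemma prod_parts_prod (f : Fin N → ℂ) : ∏ A ∈ Λ.parts, ∏ i : A, f i = ∏ i, f i := by
  conv_rhs => rw [← Λ.biUnion_parts, Finset.prod_biUnion Λ.disjoint]
  exact Finset.prod_congr rfl fun A _ => Finset.prod_coe_sort A f

variable (σ τ υ : (A : Finset (Fin N)) → QubitOp A)

lemma partitionTensor_mul :
    partitionTensor Λ σ * partitionTensor Λ τ = partitionTensor Λ fun A => σ A * τ A := by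
  ext x y
  simp only [partitionTensor, mul_apply, of_apply, ← Finset.prod_mul_distrib]
  exact sum_prod_parts Λ fun A z => σ A (fun i => x i) z * τ A z (fun i => y i)

lemma trace_partitionTensor : (partitionTensor Λ σ).trace = ∏ A ∈ Λ.parts, (σ A).trace :=
  sum_prod_parts Λ fun A z => σ A z z

lemma partitionTensor_conjTranspose :
    (partitionTensor Λ σ)ᴴ = partitionTensor Λ fun A => (σ A)ᴴ := by
  ext x y
  simp [partitionTensor, conjTranspose_apply]

lemma partitionTensor_tensorOp (M : Fin N → Matrix (Fin 2) (Fin 2) ℂ) :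
    partitionTensor Λ (fun A => tensorOp fun j : A => M j) = tensorOp M := by
  ext x y
  exact prod_parts_prod Λ fun i => M i (x i) (y i)

lemma partitionTensor_vecMulVec (v w : (A : Finset (Fin N)) → (A → Fin 2) → ℂ) :
    partitionTensor Λ (fun A => vecMulVec (v A) (w A)) =
      vecMulVec (fun x => ∏ A ∈ Λ.parts, v A fun i => x i)
        (fun x => ∏ A ∈ Λ.parts, w A fun i => x i) := by
  ext x y
  simp [partitionTensor, vecMulVec_apply, Finset.prod_mul_distrib]

variable {Λ σ τ υ}

lemma partitionTensor_congr (h : ∀ A ∈ Λ.parts, σ A = τ A) :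
    partitionTensor Λ σ = partitionTensor Λ τ := by
  ext x y
  exact Finset.prod_congr rfl fun A hA => by rw [h A hA]

open scoped MatrixOrder Matrix.Norms.L2Operator in
lemma posSemidef_partitionTensor (hσ : ∀ A ∈ Λ.parts, (σ A).PosSemidef) :
    (partitionTensor Λ σ).PosSemidef := by
  have hfactor (A : Finset (Fin N)) : ∃ B : QubitOp A, A ∈ Λ.parts → σ A = Bᴴ * B := by
    by_cases hA : A ∈ Λ.parts
    · obtain ⟨B, hB⟩ := CStarAlgebra.nonneg_iff_eq_star_mul_self.1 (hσ A hA).nonneg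
      exact ⟨B, fun _ => hB⟩
    · exact ⟨0, fun h => absurd h hA⟩
  choose B hB using hfactor
  rw [partitionTensor_congr hB, ← partitionTensor_mul Λ (fun A => (B A)ᴴ) B,
    ← partitionTensor_conjTranspose]
  exact posSemidef_conjTranspose_mul_self _

lemma isDensityMatrix_partitionTensor (hσ : ∀ A ∈ Λ.parts, IsDensityMatrix (σ A)) :
    IsDensityMatrix (partitionTensor Λ σ) :=
  ⟨posSemidef_partitionTensor fun A hA => (hσ A hA).1,
    (trace_partitionTensor Λ σ).trans (Finset.prod_eq_one fun A hA => (hσ A hA).2)⟩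

lemma trace_partitionTensor_mul_of_eq_one (hσ : ∀ A ∈ Λ.parts, (σ A).trace = 1)
    {B : Finset (Fin N)} (hB : B ∈ Λ.parts) (hτ : ∀ A ∈ Λ.parts, A ≠ B → τ A = 1) :
    (partitionTensor Λ σ * partitionTensor Λ τ).trace = (σ B * τ B).trace := by
  rw [partitionTensor_mul, trace_partitionTensor]
  exact Finset.prod_eq_single_of_mem B hB fun A hA hne => by
    rw [hτ A hA hne, Matrix.mul_one, hσ A hA]

lemma trace_partitionTensor_mul_mul (hσ : ∀ A ∈ Λ.parts, (σ A).trace = 1)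
    (hτυ : ∀ A ∈ Λ.parts, τ A = 1 ∨ υ A = 1) :
    (partitionTensor Λ σ * (partitionTensor Λ τ * partitionTensor Λ υ)).trace =
      (partitionTensor Λ σ * partitionTensor Λ τ).trace *
        (partitionTensor Λ σ * partitionTensor Λ υ).trace := by
  simp only [partitionTensor_mul, trace_partitionTensor, ← Finset.prod_mul_distrib]
  refine Finset.prod_congr rfl fun A hA => ?_
  rcases hτυ A hA with h | h <;> simp [h, hσ A hA]

lemma qfi_partitionTensor_vecMulVec_star {ψ : (A : Finset (Fin N)) → (A → Fin 2) → ℂ}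
    (hψ : ∀ A ∈ Λ.parts, ψ A ⬝ᵥ star (ψ A) = 1) {H : QubitOp (Fin N)} (hH : H.IsHermitian) :
    qfi (partitionTensor Λ fun A => vecMulVec (ψ A) (star (ψ A))) H =
      4 * covariance (partitionTensor Λ fun A => vecMulVec (ψ A) (star (ψ A))) H H := by
  have hpure : partitionTensor Λ (fun A => vecMulVec (ψ A) (star (ψ A))) =
      vecMulVec (fun x => ∏ A ∈ Λ.parts, ψ A fun i => x i)
        (star fun x => ∏ A ∈ Λ.parts, ψ A fun i => x i) := by
    rw [partitionTensor_vecMulVec]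
    congr 1
    ext x
    simp
  rw [hpure, qfi_vecMulVec_star _ hH]
  rw [← trace_vecMulVec, ← hpure, trace_partitionTensor]
  exact Finset.prod_eq_one fun A hA => by rw [trace_vecMulVec, hψ A hA]

/-- The operator `K` on the qubit `i`, restricted to the qubits in `A`; the identity if `i` is not
in `A`. -/
noncomputable def localSiteOp (A : Finset (Fin N)) (i : Fin N) (K : Matrix (Fin 2) (Fin 2) ℂ) :
    QubitOp A :=
  tensorOp fun j : A => if (j : Fin N) = i then K else 1

lemma siteOp_eq_partitionTensor (Λ : QubitPartition N) (i : Fin N)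
    (K : Matrix (Fin 2) (Fin 2) ℂ) :
    siteOp i K = partitionTensor Λ fun A => localSiteOp A i K :=
  (partitionTensor_tensorOp Λ _).symm

lemma localSiteOp_of_notMem {A : Finset (Fin N)} {i : Fin N} (h : i ∉ A)
    (K : Matrix (Fin 2) (Fin 2) ℂ) : localSiteOp A i K = 1 := by
  have hne (j : A) : (j : Fin N) ≠ i := fun hj => h (hj ▸ j.2)
  simp only [localSiteOp, hne, if_false, tensorOp_one]

lemma covariance_siteOp_of_part_ne (hσ : ∀ A ∈ Λ.parts, IsDensityMatrix (σ A)) {i j : Fin N}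
    (hij : Λ.part i ≠ Λ.part j) {K L : Matrix (Fin 2) (Fin 2) ℂ} (hK : K.IsHermitian)
    (hL : L.IsHermitian) :
    covariance (partitionTensor Λ σ) (siteOp i K) (siteOp j L) = 0 := by
  have hρ := (isDensityMatrix_partitionTensor hσ).1.1
  have hone : ∀ A ∈ Λ.parts, localSiteOp A i K = 1 ∨ localSiteOp A j L = 1 := by
    intro A hA
    by_cases hi : i ∈ A
    · exact .inr (localSiteOp_of_notMem (fun hj => hij <|
        (Λ.part_eq_of_mem hA hi).trans (Λ.part_eq_of_mem hA hj).symm) L)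
    · exact .inl (localSiteOp_of_notMem hi K)
  have htrace := trace_partitionTensor_mul_mul (fun A hA => (hσ A hA).2) hone
  rw [← siteOp_eq_partitionTensor, ← siteOp_eq_partitionTensor,
    trace_mul_eq_expval hρ (isHermitian_siteOp i hK),
    trace_mul_eq_expval hρ (isHermitian_siteOp j hL)] at htrace
  rw [covariance, expval, htrace, ← Complex.ofReal_mul, Complex.ofReal_re, sub_self]

lemma covariance_siteOp_of_mem (hσ : ∀ A ∈ Λ.parts, (σ A).trace = 1) {B : Finset (Fin N)}
    (hB : B ∈ Λ.parts) {i j : Fin N} (hi : i ∈ B) (hj : j ∈ B) (K L : Matrix (Fin 2) (Fin 2) ℂ) :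
    covariance (partitionTensor Λ σ) (siteOp i K) (siteOp j L) =
      covariance (σ B) (localSiteOp B i K) (localSiteOp B j L) := by
  have hone {k : Fin N} (hk : k ∈ B) (M : Matrix (Fin 2) (Fin 2) ℂ) :
      ∀ A ∈ Λ.parts, A ≠ B → localSiteOp A k M = 1 := fun A hA hne =>
    localSiteOp_of_notMem (fun hkA => hne (Λ.eq_of_mem_parts hA hB hkA hk)) M
  simp only [covariance, expval, siteOp_eq_partitionTensor Λ]
  rw [partitionTensor_mul, trace_partitionTensor_mul_of_eq_one hσ hB (hone hi K),
    trace_partitionTensor_mul_of_eq_one hσ hB (hone hj L),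
    trace_partitionTensor_mul_of_eq_one hσ hB fun A hA hne => by
      rw [hone hi K A hA hne, hone hj L A hA hne, Matrix.mul_one]]

end PartitionTensor

section UpperBound

variable {N : ℕ} {Λ : QubitPartition N} {K : Matrix (Fin 2) (Fin 2) ℂ}

lemma sum_card_part (Λ : QubitPartition N) :
    ∑ i, (Λ.part i).card = ∑ A ∈ Λ.parts, A.card ^ 2 := by
  have hblocks := Finset.sum_biUnion Λ.disjoint (f := fun i => (Λ.part i).card)
  rw [Λ.biUnion_parts] at hblocks
  refine hblocks.trans (Finset.sum_congr rfl fun A hA => ?_)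
  rw [id, Finset.sum_congr rfl fun i hi => by rw [Λ.part_eq_of_mem hA hi], Finset.sum_const,
    smul_eq_mul, sq]

lemma sum_sum_ite_part_eq (Λ : QubitPartition N) (c : ℝ) :
    ∑ i, ∑ j, (if Λ.part i = Λ.part j then c else 0) =
      c * (∑ A ∈ Λ.parts, A.card ^ 2 : ℕ) := by
  rw [← sum_card_part, Nat.cast_sum, Finset.mul_sum]
  refine Finset.sum_congr rfl fun i _ => ?_
  have hpart : Finset.univ.filter (fun j => Λ.part i = Λ.part j) = Λ.part i := by
    ext j
    rw [Finset.mem_filter, Λ.mem_part_iff_part_eq_part (Finset.mem_univ j) (Finset.mem_univ i)]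
    simp [eq_comm]
  rw [← Finset.sum_filter, hpart, Finset.sum_const, nsmul_eq_mul, mul_comm]

lemma covariance_siteOp_le {σ : (A : Finset (Fin N)) → QubitOp A}
    (hσ : ∀ A ∈ Λ.parts, IsDensityMatrix (σ A)) (hK : K.IsHermitian) (i j : Fin N) :
    covariance (partitionTensor Λ σ) (siteOp i K) (siteOp j K) ≤
      if Λ.part i = Λ.part j then (hK.eigenvalues 0 - hK.eigenvalues 1) ^ 2 / 4 else 0 := by
  have hρ := isDensityMatrix_partitionTensor hσ
  split_ifs with hij
  · exact covariance_le_of_covariance_self_le hρ (isHermitian_siteOp i hK)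
      (isHermitian_siteOp j hK) (covariance_siteOp_self_le hρ.2 i hK)
      (covariance_siteOp_self_le hρ.2 j hK)
  · exact (covariance_siteOp_of_part_ne hσ hij hK hK).le

lemma qfi_partitionTensor_le {σ : (A : Finset (Fin N)) → QubitOp A}
    (hσ : ∀ A ∈ Λ.parts, IsDensityMatrix (σ A)) (hK : K.IsHermitian) :
    qfi (partitionTensor Λ σ) (∑ i, siteOp i K) ≤
      (hK.eigenvalues 0 - hK.eigenvalues 1) ^ 2 * (∑ A ∈ Λ.parts, A.card ^ 2 : ℕ) := by
  calc qfi (partitionTensor Λ σ) (∑ i, siteOp i K)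
      ≤ 4 * covariance (partitionTensor Λ σ) (∑ i, siteOp i K) (∑ i, siteOp i K) :=
        qfi_le_four_mul_covariance (isDensityMatrix_partitionTensor hσ) (isHermitian_sum_siteOp hK)
    _ ≤ 4 * ∑ i, ∑ j,
          if Λ.part i = Λ.part j then (hK.eigenvalues 0 - hK.eigenvalues 1) ^ 2 / 4 else 0 := by
        rw [covariance_sum_sum]
        gcongr with i _ j _
        exact covariance_siteOp_le hσ hK i j
    _ = _ := by
        rw [sum_sum_ite_part_eq]
        ring

lemma IsPartitionSeparable.posSemidef {ρ : QubitOp (Fin N)} (hρ : IsPartitionSeparable Λ ρ) :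
    ρ.PosSemidef := by
  obtain ⟨m, p, σ, hp, -, hσ, rfl⟩ := hρ
  exact posSemidef_sum _ fun γ _ =>
    (isDensityMatrix_partitionTensor (hσ γ)).1.smul (Complex.zero_le_real.2 (hp γ))

lemma IsPartitionSeparable.qfi_le {ρ : QubitOp (Fin N)} (hρ : IsPartitionSeparable Λ ρ)
    (hK : K.IsHermitian) :
    qfi ρ (∑ i, siteOp i K) ≤
      (hK.eigenvalues 0 - hK.eigenvalues 1) ^ 2 * (∑ A ∈ Λ.parts, A.card ^ 2 : ℕ) := by
  obtain ⟨m, p, σ, hp, hp1, hσ, rfl⟩ := hρ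
  exact qfi_mixture_le (fun γ _ => hp γ) hp1
    (fun γ _ => (isDensityMatrix_partitionTensor (hσ γ)).1) (isHermitian_sum_siteOp hK)
    fun γ _ => qfi_partitionTensor_le (hσ γ) hK

lemma HasDysonRankLE.qfi_le {r : ℤ} {ρ : QubitOp (Fin N)} (hρ : HasDysonRankLE r ρ)
    (hK : K.IsHermitian) :
    qfi ρ (∑ i, siteOp i K) ≤
      (hK.eigenvalues 0 - hK.eigenvalues 1) ^ 2 * rankBound N r := by
  obtain ⟨P, τ, hP, hP1, hτ, rfl⟩ := hρ
  refine qfi_mixture_le hP hP1 (fun Λ hΛ => (hτ Λ hΛ).posSemidef) (isHermitian_sum_siteOp hK)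
    fun Λ hΛ => ((hτ Λ hΛ).qfi_le hK).trans ?_
  gcongr
  exact Finset.le_sup (f := fun Λ : QubitPartition N => ∑ A ∈ Λ.parts, A.card ^ 2) hΛ

end UpperBound

section RankBound

variable {N : ℕ}

lemma rankPartitions_nonempty {r : ℤ} (hr : -((N : ℤ) - 1) ≤ r) :
    (rankPartitions N r).Nonempty := by
  refine ⟨⊥, Finset.mem_filter.2 ⟨Finset.mem_univ _, ?_⟩⟩
  have hwidth : partitionWidth (⊥ : QubitPartition N) ≤ 1 := Finset.sup_le fun A hA => by
    obtain ⟨a, -, rfl⟩ := Finpartition.mem_bot_iff.1 hA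
    exact (Finset.card_singleton a).le
  have hheight : partitionHeight (⊥ : QubitPartition N) = N := by simp [partitionHeight]
  rw [dysonRank, hheight]
  omega

lemma exists_sum_card_sq_eq_rankBound {r : ℤ} (hr : -((N : ℤ) - 1) ≤ r) :
    ∃ Λ ∈ rankPartitions N r, ∑ A ∈ Λ.parts, A.card ^ 2 = rankBound N r := by
  obtain ⟨Λ, hΛ, hmax⟩ := Finset.exists_mem_eq_sup (rankPartitions N r)
    (rankPartitions_nonempty hr) fun Λ => ∑ A ∈ Λ.parts, A.card ^ 2
  exact ⟨Λ, hΛ, hmax.symm⟩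

variable (Λ : QubitPartition N)

lemma sum_card_eq : ∑ A ∈ Λ.parts, (A.card : ℤ) = N := by
  rw [← Nat.cast_sum, Λ.sum_card_parts, Finset.card_univ, Fintype.card_fin]

lemma sum_card_sub_one :
    ∑ A ∈ Λ.parts, ((A.card : ℤ) - 1) = N - partitionHeight Λ := by
  rw [Finset.sum_sub_distrib, sum_card_eq, Finset.sum_const, nsmul_one, partitionHeight]

lemma sum_card_sq_eq :
    ∑ A ∈ Λ.parts, (A.card : ℤ) ^ 2 = N + ∑ A ∈ Λ.parts, (A.card : ℤ) * (A.card - 1) := by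
  rw [← sum_card_eq Λ, ← Finset.sum_add_distrib]
  exact Finset.sum_congr rfl fun A _ => by ring

variable {Λ}

lemma card_sub_one_nonneg {A : Finset (Fin N)} (hA : A ∈ Λ.parts) : 0 ≤ (A.card : ℤ) - 1 := by
  have := (Λ.nonempty_of_mem_parts hA).card_pos
  omega

lemma card_le_partitionWidth {A : Finset (Fin N)} (hA : A ∈ Λ.parts) :
    (A.card : ℤ) ≤ partitionWidth Λ :=
  Nat.cast_le.2 (Finset.le_sup hA)

lemma sum_card_mul_card_sub_one_le_width_mul (Λ : QubitPartition N) :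
    ∑ A ∈ Λ.parts, (A.card : ℤ) * (A.card - 1) ≤
      partitionWidth Λ * (N - partitionHeight Λ) := by
  rw [← sum_card_sub_one, Finset.mul_sum]
  exact Finset.sum_le_sum fun A hA =>
    mul_le_mul_of_nonneg_right (card_le_partitionWidth hA) (card_sub_one_nonneg hA)

lemma sum_card_mul_card_sub_one_le_of_mem {B : Finset (Fin N)} (hB : B ∈ Λ.parts) {e : ℤ}
    (he : (N : ℤ) - partitionHeight Λ = B.card - 1 + e) :
    ∑ A ∈ Λ.parts, (A.card : ℤ) * (A.card - 1) ≤ B.card * (B.card - 1) + (e + 1) * e := by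
  have hrest : ∑ A ∈ Λ.parts.erase B, ((A.card : ℤ) - 1) = e := by
    rw [Finset.sum_erase_eq_sub hB, sum_card_sub_one, he, add_sub_cancel_left]
  have hnonneg : ∀ A ∈ Λ.parts.erase B, 0 ≤ (A.card : ℤ) - 1 := fun A hA =>
    card_sub_one_nonneg (Finset.mem_of_mem_erase hA)
  rw [← Finset.add_sum_erase _ _ hB, ← hrest, Finset.mul_sum]
  gcongr with A hA
  · exact hnonneg A hA
  · have := Finset.single_le_sum hnonneg hA
    linarith

lemma partitionHeight_le : (partitionHeight Λ : ℤ) ≤ N := by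
  rw [← sub_nonneg, ← sum_card_sub_one]
  exact Finset.sum_nonneg fun A hA => card_sub_one_nonneg hA

lemma two_le_partitionWidth (hΛ : (partitionHeight Λ : ℤ) < N) : 2 ≤ partitionWidth Λ := by
  by_contra! hwidth
  rw [← sub_pos, ← sum_card_sub_one] at hΛ
  refine hΛ.not_ge (Finset.sum_nonpos fun A hA => ?_)
  have := card_le_partitionWidth hA
  omega

lemma sum_card_mul_card_sub_one_le_of_width_eq
    (hΛ : (partitionWidth Λ : ℤ) = N - partitionHeight Λ) :
    ∑ A ∈ Λ.parts, (A.card : ℤ) * (A.card - 1) ≤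
      partitionWidth Λ * (partitionWidth Λ - 1) + 2 := by
  rcases Λ.parts.eq_empty_or_nonempty with hempty | hne
  · simp [hempty, partitionWidth]
  · obtain ⟨B, hB, hBwidth⟩ := Finset.exists_mem_eq_sup Λ.parts hne Finset.card
    rw [partitionWidth, hBwidth] at hΛ ⊢
    exact sum_card_mul_card_sub_one_le_of_mem hB (e := 1) (by rw [← hΛ, sub_add_cancel])

lemma sum_card_mul_card_sub_one_le {r : ℤ} (hr : -((N : ℤ) - 1) ≤ r) (hΛ : dysonRank Λ ≤ r) :
    (r ≠ 4 - N → 4 * ∑ A ∈ Λ.parts, (A.card : ℤ) * (A.card - 1) ≤ (N + r) ^ 2 - 1) ∧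
      (r = 4 - N → ∑ A ∈ Λ.parts, (A.card : ℤ) * (A.card - 1) ≤ 4) := by
  have hwidth := sum_card_mul_card_sub_one_le_width_mul Λ
  have hheight_le := partitionHeight_le (Λ := Λ)
  rw [dysonRank] at hΛ
  rcases ne_or_eq (partitionWidth Λ : ℤ) (N - partitionHeight Λ) with hne | heq
  · have hdiff : 0 < ((partitionWidth Λ : ℤ) - (N - partitionHeight Λ)) ^ 2 :=
      sq_pos_of_ne_zero (sub_ne_zero.2 hne)
    have hrank : ((partitionWidth Λ : ℤ) + (N - partitionHeight Λ)) ^ 2 ≤ (N + r) ^ 2 :=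
      pow_le_pow_left₀ (by omega) (by omega) 2
    have hbound : 4 * ∑ A ∈ Λ.parts, (A.card : ℤ) * (A.card - 1) ≤ (N + r) ^ 2 - 1 := by linarith
    refine ⟨fun _ => hbound, ?_⟩
    rintro rfl
    linarith
  · have hsum := sum_card_mul_card_sub_one_le_of_width_eq heq
    rcases hheight_le.eq_or_lt with hheight | hheight
    · rw [hheight, sub_self, mul_zero] at hwidth
      have hrank : 1 ^ 2 ≤ ((N : ℤ) + r) ^ 2 := pow_le_pow_left₀ zero_le_one (by omega) 2
      exact ⟨fun _ => by linarith, fun _ => by linarith⟩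
    · have htwo : (2 : ℤ) ≤ partitionWidth Λ := Nat.cast_le.2 (two_le_partitionWidth hheight)
      have hrank : 2 * (partitionWidth Λ : ℤ) ≤ N + r := by omega
      rcases htwo.eq_or_lt with hpair | hthree
      · rw [← hpair] at hsum
        refine ⟨fun hr4 => ?_, fun _ => by linarith⟩
        have hfive : 5 ≤ (N : ℤ) + r := by omega
        nlinarith
      · exact ⟨fun _ => by nlinarith, fun hr4 => by omega⟩

lemma rankBound_le {r : ℤ} (hr : -((N : ℤ) - 1) ≤ r) :
    (r ≠ 4 - (N : ℤ) → (rankBound N r : ℝ) ≤ ((N : ℝ) + (r : ℝ)) ^ 2 / 4 - 1 / 4 + (N : ℝ)) ∧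
      (r = 4 - (N : ℤ) → (rankBound N r : ℝ) ≤ (N : ℝ) + 4) := by
  obtain ⟨Λ, hΛ, hmax⟩ := exists_sum_card_sq_eq_rankBound hr
  have hsum : (rankBound N r : ℝ) = N + (∑ A ∈ Λ.parts, (A.card : ℤ) * (A.card - 1) : ℤ) := by
    rw [← hmax]
    exact_mod_cast sum_card_sq_eq Λ
  obtain ⟨hle, hle_four⟩ := sum_card_mul_card_sub_one_le hr (Finset.mem_filter.1 hΛ).2
  rw [hsum]
  refine ⟨fun h => ?_, fun h => ?_⟩
  · have hle' := Int.cast_le (R := ℝ).2 (hle h)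
    push_cast at hle' ⊢
    linarith
  · have hle' := Int.cast_le (R := ℝ).2 (hle_four h)
    push_cast at hle' ⊢
    linarith

end RankBound

section GHZ

/-- The vector `(c₀ e₀ ⊗ ⋯ ⊗ e₀ + c₁ e₁ ⊗ ⋯ ⊗ e₁) / √2`. At `c = 1` this is the
Greenberger-Horne-Zeilinger vector of the pair `e`, and the weights `c` keep track of the operators
diagonal in `e` acting on it. -/
noncomputable def ghzVec (ι : Type) [Fintype ι] (e : Fin 2 → Fin 2 → ℂ) (c : Fin 2 → ℂ) :
    (ι → Fin 2) → ℂ :=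
  ((√2)⁻¹ : ℂ) • ∑ k, c k • tensorVec fun _ => e k

variable {e : Fin 2 → Fin 2 → ℂ}

lemma ghzVec_dotProduct_star {ι : Type} [Fintype ι] [DecidableEq ι] [Nonempty ι]
    (he : ∀ k l, e k ⬝ᵥ star (e l) = if k = l then 1 else 0) (c : Fin 2 → ℂ) :
    ghzVec ι e c ⬝ᵥ star (ghzVec ι e 1) = (∑ k, c k) / 2 := by
  have hpair (k l : Fin 2) : tensorVec (fun _ : ι => e k) ⬝ᵥ star (tensorVec fun _ : ι => e l) =
      if k = l then 1 else 0 := by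
    rw [tensorVec_dotProduct_star, he]
    split_ifs <;> simp
  have hnorm : ((√2 : ℝ) : ℂ)⁻¹ * ((√2 : ℝ) : ℂ)⁻¹ = 1 / 2 := by
    rw [← mul_inv, ← Complex.ofReal_mul, Real.mul_self_sqrt zero_le_two, one_div,
      Complex.ofReal_ofNat]
  simp only [ghzVec, star_smul, star_sum, smul_dotProduct, dotProduct_smul, sum_dotProduct,
    dotProduct_sum, hpair]
  simp only [star_inv₀, RCLike.star_def, Complex.conj_ofReal, Pi.one_apply, star_one, smul_eq_mul,
    mul_ite, mul_one, mul_zero, Finset.sum_ite_eq', Finset.mem_univ, if_true, one_mul,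
    Fin.sum_univ_two]
  linear_combination (c 0 + c 1) * hnorm

variable {N : ℕ} {A : Finset (Fin N)} {K : Matrix (Fin 2) (Fin 2) ℂ}

lemma localSiteOp_mulVec_ghzVec {a : Fin 2 → ℂ} {i : Fin N} (hi : i ∈ A)
    (hK : ∀ k, K *ᵥ e k = a k • e k) (c : Fin 2 → ℂ) :
    localSiteOp A i K *ᵥ ghzVec A e c = ghzVec A e (a * c) := by
  have hpow (k : Fin 2) : localSiteOp A i K *ᵥ tensorVec (fun _ : A => e k) =
      a k • tensorVec fun _ : A => e k := by
    have hfactor : (fun j : A => (if (j : Fin N) = i then K else 1) *ᵥ e k) =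
        fun j : A => (if (j : Fin N) = i then a k else 1) • e k := by
      ext j : 1
      split_ifs
      · exact hK k
      · rw [one_mulVec, one_smul]
    rw [localSiteOp, tensorOp_mulVec, hfactor, tensorVec_smul]
    congr 1
    rw [Finset.prod_coe_sort A fun j => if j = i then a k else 1, Finset.prod_ite_eq' A i,
      if_pos hi]
  simp only [ghzVec, mulVec_smul, mulVec_sum, hpow, smul_smul, Pi.mul_apply, mul_comm (c _)]

/-- The pure state of the vector `ghzVec A e 1` of the qubits in `A`. -/
noncomputable def ghzState (e : Fin 2 → Fin 2 → ℂ) (A : Finset (Fin N)) : QubitOp A :=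
  vecMulVec (ghzVec A e 1) (star (ghzVec A e 1))

variable (he : ∀ k l, e k ⬝ᵥ star (e l) = if k = l then 1 else 0)
include he

lemma ghzVec_one_dotProduct_star (hA : A.Nonempty) : ghzVec A e 1 ⬝ᵥ star (ghzVec A e 1) = 1 := by
  have := hA.coe_sort
  simp [ghzVec_dotProduct_star he]

lemma isDensityMatrix_ghzState (hA : A.Nonempty) : IsDensityMatrix (ghzState e A) :=
  isDensityMatrix_vecMulVec_star (ghzVec_one_dotProduct_star he hA)

lemma covariance_ghzState_localSiteOp {s : Fin 2 → ℝ} (hK : ∀ k, K *ᵥ e k = (s k : ℂ) • e k)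
    {i j : Fin N} (hi : i ∈ A) (hj : j ∈ A) :
    covariance (ghzState e A) (localSiteOp A i K) (localSiteOp A j K) = (s 0 - s 1) ^ 2 / 4 := by
  have : Nonempty A := ⟨⟨i, hi⟩⟩
  simp only [covariance, ghzState, expval_vecMulVec_star, ← mulVec_mulVec,
    localSiteOp_mulVec_ghzVec hi hK, localSiteOp_mulVec_ghzVec hj hK, ghzVec_dotProduct_star he]
  simp only [mul_one, Pi.mul_apply, Pi.one_apply, Fin.sum_univ_two, Complex.div_ofNat_re,
    Complex.add_re, Complex.mul_re, Complex.ofReal_re, Complex.ofReal_im, mul_zero, sub_zero]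
  ring

lemma qfi_partitionTensor_ghzState (hK : K.IsHermitian) {s : Fin 2 → ℝ}
    (hs : ∀ k, K *ᵥ e k = (s k : ℂ) • e k) (Λ : QubitPartition N) :
    qfi (partitionTensor Λ (ghzState e)) (∑ i, siteOp i K) =
      (s 0 - s 1) ^ 2 * (∑ A ∈ Λ.parts, A.card ^ 2 : ℕ) := by
  have hσ : ∀ A ∈ Λ.parts, IsDensityMatrix (ghzState e A) := fun A hA =>
    isDensityMatrix_ghzState he (Λ.nonempty_of_mem_parts hA)
  have hcov (i j : Fin N) : covariance (partitionTensor Λ (ghzState e)) (siteOp i K) (siteOp j K) =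
      if Λ.part i = Λ.part j then (s 0 - s 1) ^ 2 / 4 else 0 := by
    split_ifs with hij
    · have hi : i ∈ Λ.part i := Λ.mem_part_self.2 (Finset.mem_univ i)
      have hj : j ∈ Λ.part i := hij ▸ Λ.mem_part_self.2 (Finset.mem_univ j)
      rw [covariance_siteOp_of_mem (fun A hA => (hσ A hA).2) (Λ.part_mem.2 (Finset.mem_univ i)) hi
        hj, covariance_ghzState_localSiteOp he hs hi hj]
    · exact covariance_siteOp_of_part_ne hσ hij hK hK
  calc qfi (partitionTensor Λ (ghzState e)) (∑ i, siteOp i K)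
      = 4 * covariance (partitionTensor Λ (ghzState e)) (∑ i, siteOp i K) (∑ i, siteOp i K) :=
        qfi_partitionTensor_vecMulVec_star
          (fun A hA => ghzVec_one_dotProduct_star he (Λ.nonempty_of_mem_parts hA))
          (isHermitian_sum_siteOp hK)
    _ = 4 * ((s 0 - s 1) ^ 2 / 4 * (∑ A ∈ Λ.parts, A.card ^ 2 : ℕ)) := by
        simp only [covariance_sum_sum, hcov, sum_sum_ite_part_eq]
    _ = _ := by ring

end GHZ

section Attainment

variable {N : ℕ}

lemma exists_orthonormal_eigenvectors {K : Matrix (Fin 2) (Fin 2) ℂ} (hK : K.IsHermitian) :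
    ∃ e : Fin 2 → Fin 2 → ℂ, (∀ k l, e k ⬝ᵥ star (e l) = if k = l then 1 else 0) ∧
      ∀ k, K *ᵥ e k = (hK.eigenvalues k : ℂ) • e k := by
  refine ⟨fun k => hK.eigenvectorBasis k, fun k l => ?_, fun k => ?_⟩
  · rw [← EuclideanSpace.inner_eq_star_dotProduct,
      orthonormal_iff_ite.1 hK.eigenvectorBasis.orthonormal]
    simp only [eq_comm]
  · exact hK.mulVec_eigenvectorBasis k

lemma hasDysonRankLE_partitionTensor {r : ℤ} {Λ : QubitPartition N} (hΛ : Λ ∈ rankPartitions N r)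
    {σ : (A : Finset (Fin N)) → QubitOp A} (hσ : ∀ A : Finset (Fin N), A.Nonempty →
      IsDensityMatrix (σ A)) : HasDysonRankLE r (partitionTensor Λ σ) := by
  classical
  refine ⟨Pi.single Λ 1, fun Λ' => partitionTensor Λ' σ, fun Λ' _ => ?_, ?_, fun Λ' _ => ?_, ?_⟩
  · rw [Pi.single_apply]
    split_ifs <;> norm_num
  · rw [Finset.sum_pi_single', if_pos hΛ]
  · exact ⟨1, fun _ => 1, fun _ => σ, by simp, by simp,
      fun _ A hA => hσ A (Λ'.nonempty_of_mem_parts hA), by simp⟩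
  · rw [Finset.sum_eq_single_of_mem Λ hΛ fun Λ' _ hne => by simp [hne]]
    simp

lemma exists_hasDysonRankLE_qfi_eq {r : ℤ} (hr : -((N : ℤ) - 1) ≤ r)
    {K : Matrix (Fin 2) (Fin 2) ℂ} (hK : K.IsHermitian) :
    ∃ ρ : QubitOp (Fin N), HasDysonRankLE r ρ ∧ qfi ρ (∑ i, siteOp i K) =
      (hK.eigenvalues 0 - hK.eigenvalues 1) ^ 2 * rankBound N r := by
  obtain ⟨Λ, hΛ, hmax⟩ := exists_sum_card_sq_eq_rankBound hr
  obtain ⟨e, he, hKe⟩ := exists_orthonormal_eigenvectors hK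
  refine ⟨partitionTensor Λ (ghzState e),
    hasDysonRankLE_partitionTensor hΛ fun A hA => isDensityMatrix_ghzState he hA, ?_⟩
  rw [qfi_partitionTensor_ghzState he hK hKe, hmax]

end Attainment

theorem mainTheorem5_general (N : ℕ) (r : ℤ) (hr : -((N : ℤ) - 1) ≤ r)
    {K : Matrix (Fin 2) (Fin 2) ℂ} (hK : K.IsHermitian) :
    IsGreatest ((fun ρ : QubitOp (Fin N) => qfi ρ (∑ i, siteOp i K)) '' {ρ | HasDysonRankLE r ρ})
      ((hK.eigenvalues 0 - hK.eigenvalues 1) ^ 2 * rankBound N r) ∧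
    (r ≠ 4 - (N : ℤ) → ∀ ρ : QubitOp (Fin N), HasDysonRankLE r ρ →
      qfi ρ (∑ i, siteOp i K) ≤ (hK.eigenvalues 0 - hK.eigenvalues 1) ^ 2 *
        (((N : ℝ) + (r : ℝ)) ^ 2 / 4 - 1 / 4 + (N : ℝ))) ∧
    (r = 4 - (N : ℤ) → ∀ ρ : QubitOp (Fin N), HasDysonRankLE r ρ →
      qfi ρ (∑ i, siteOp i K) ≤ (hK.eigenvalues 0 - hK.eigenvalues 1) ^ 2 * ((N : ℝ) + 4)) := by
  obtain ⟨hne, heq⟩ := rankBound_le hr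
  have hgap := sq_nonneg (hK.eigenvalues 0 - hK.eigenvalues 1)
  refine ⟨⟨exists_hasDysonRankLE_qfi_eq hr hK, ?_⟩,
    fun h ρ hρ => (hρ.qfi_le hK).trans (mul_le_mul_of_nonneg_left (hne h) hgap),
    fun h ρ hρ => (hρ.qfi_le hK).trans (mul_le_mul_of_nonneg_left (heq h) hgap)⟩
  rintro _ ⟨ρ, hρ, rfl⟩
  exact hρ.qfi_le hK

section CollectiveSpin

/-- The spin `n·σ / 2` of a single qubit in the direction `n`. -/
noncomputable def spinDir (n : EuclideanSpace ℝ (Fin 3)) : Matrix (Fin 2) (Fin 2) ℂ :=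
  ∑ a : Fin 3, ((n a / 2 : ℝ) : ℂ) • pauli a

lemma collectiveSpin_eq_sum (N : ℕ) (n : EuclideanSpace ℝ (Fin 3)) :
    collectiveSpin N n = ∑ i : Fin N, siteOp i (spinDir n) := by
  simp only [collectiveSpin, spinDir, ← siteStarAlgHom_apply, map_sum, map_smul]

variable (n : EuclideanSpace ℝ (Fin 3))

lemma spinDir_eq : spinDir n = !![(n 2 / 2 : ℂ), n 0 / 2 - n 1 / 2 * Complex.I;
    n 0 / 2 + n 1 / 2 * Complex.I, -(n 2 / 2 : ℂ)] := by
  ext i j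
  fin_cases i <;> fin_cases j <;> simp [spinDir, pauli, Fin.sum_univ_three, sub_eq_add_neg]

lemma isHermitian_spinDir : (spinDir n).IsHermitian := by
  rw [spinDir_eq]
  refine Matrix.IsHermitian.ext fun i j => ?_
  fin_cases i <;> fin_cases j <;> simp [sub_eq_add_neg]

lemma trace_spinDir : (spinDir n).trace = 0 := by
  simp [spinDir_eq, trace_fin_two]

lemma det_spinDir : (spinDir n).det = ((-(‖n‖ ^ 2 / 4) : ℝ) : ℂ) := by
  rw [spinDir_eq, det_fin_two_of, EuclideanSpace.real_norm_sq_eq, Fin.sum_univ_three]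
  push_cast
  linear_combination (n 1 : ℂ) ^ 2 / 4 * Complex.I_mul_I

lemma sq_eigenvalues_spinDir_sub :
    ((isHermitian_spinDir n).eigenvalues 0 - (isHermitian_spinDir n).eigenvalues 1) ^ 2 =
      ‖n‖ ^ 2 := by
  have htrace := trace_eq_add_eigenvalues (isHermitian_spinDir n)
  have hdet := det_eq_mul_eigenvalues (isHermitian_spinDir n)
  rw [trace_spinDir, ← Complex.ofReal_zero, Complex.ofReal_inj] at htrace
  rw [det_spinDir, Complex.ofReal_inj] at hdet
  linear_combination 4 * hdet -
    ((isHermitian_spinDir n).eigenvalues 0 + (isHermitian_spinDir n).eigenvalues 1) * htrace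

end CollectiveSpin

theorem mainTheorem5 (N : ℕ) (hN : 1 ≤ N) (r : ℤ) (hr : -((N : ℤ) - 1) ≤ r)
    (n : EuclideanSpace ℝ (Fin 3)) (hn : ‖n‖ = 1) :
    IsGreatest
      ((fun ρ : QubitOp (Fin N) => qfi ρ (collectiveSpin N n)) '' {ρ | HasDysonRankLE r ρ})
      (rankBound N r : ℝ) ∧
    (r ≠ 4 - (N : ℤ) → ∀ ρ : QubitOp (Fin N), HasDysonRankLE r ρ →
      qfi ρ (collectiveSpin N n) ≤ ((N : ℝ) + (r : ℝ)) ^ 2 / 4 - 1 / 4 + (N : ℝ)) ∧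
    (r = 4 - (N : ℤ) → ∀ ρ : QubitOp (Fin N), HasDysonRankLE r ρ →
      qfi ρ (collectiveSpin N n) ≤ (N : ℝ) + 4) := by
  have h := mainTheorem5_general N r hr (isHermitian_spinDir n)
  simpa only [← collectiveSpin_eq_sum, sq_eigenvalues_spinDir_sub, hn, one_pow, one_mul] using h
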